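/- Fix a finite set $\mathsf{Agt}$ of agents and a countable set $\mathsf{Prop}$ of propositional variables. Formulas are given by $\alpha ::= p \mid \bot \mid \alpha\wedge\alpha \mid \alpha\vee\alpha \mid \alpha\to\alpha \mid \neg\alpha \mid D_G\alpha$ with $p\in\mathsf{Prop}$ and $\emptyset\neq G\subseteq\mathsf{Agt}$. A formula $D_G\alpha$ is called outmost boxed; if $H\subseteq G$, then $D_H\beta$ is called a $G$-sub formula. $\mathsf V(\cdot)$ and $\mathsf{Agt}(\cdot)$ denote the sets of propositional variables and of agents occurring in a formula or in a multiset of formulas. A $\mathbf T$-sequent $\Sigma|\Gamma\Rightarrow\Delta$ consists of finite multisets of formulas in which $\Sigma$ contains only outmost boxed formulas. The calculus $\mathsf G(\mathbf{KT}^+_D)$ derives $\mathbf T$-sequents from the initial sequents $\Sigma|\Gamma,q\Rightarrow q,\Delta$ (for $q\in\mathsf{Prop}$) and $\Sigma|\bot,\Gamma\Rightarrow\Delta$ by the usual multiset $\mathsf{G3}$ left and right rules for $\wedge,\vee,\to,\neg$ (leaving $\Sigma$ unchanged) and the two modal rules - $(D_K^+)$: from $\emptyset|\alpha_1,\dots,\alpha_n\Rightarrow\beta$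 infer $\Sigma,D_{G_1}\alpha_1,\dots,D_{G_n}\alpha_n|\Pi\Rightarrow D_G\beta,\Omega$, where $n\ge 0$, every $G_i\subseteq G$, $\Sigma$ contains only outmost boxed formulas that are not $G$-sub formulas, $\Pi$ contains only propositional variables and $\bot$, and $\Omega$ contains only propositional variables, $\bot$ and outmost boxed formulas; - $(D_T^+)$: from $D_G\alpha,\Sigma|\Gamma,\alpha\Rightarrow\Delta$ infer $\Sigma|\Gamma,D_G\alpha\Rightarrow\Delta$. **Theorem.** Let $\Gamma,\Delta$ be finite multisets of formulas and $\Sigma$ a finite multiset of outmost boxed formulas. For every propositional variable $p$ and every agent $a$ there exists a formula $A=\mathcal A_{(p,a)}(\Sigma|\Gamma;\Delta)$ such that: 1. $\mathsf V(A)\subseteq\mathsf V(\Sigma\cup\Gamma\cup\Delta)\setminus\{p\}$ and $\mathsf{Agt}(A)\subseteq\mathsf{Agt}(\Sigma\cup\Gamma\cup\Delta)\setminus\{a\}$; 2. $\mathsf G(\mathbf{KT}^+_D)\vdash\Sigma|\Gamma,A\Rightarrow\Delta$; 3. for all finite multisets $\Pi,\Lambda$ of formulas and every finite multiset $\Theta$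 of outmost boxed formulas with $p\notin\mathsf V(\Pi\cup\Lambda\cup\Theta)$ and $a\notin\mathsf{Agt}(\Pi\cup\Lambda\cup\Theta)$, if $\mathsf G(\mathbf{KT}^+_D)\vdash\Theta,\Sigma|\Pi,\Gamma\Rightarrow\Delta,\Lambda$, then $\mathsf G(\mathbf{KT}^+_D)\vdash\emptyset|\Theta,\Pi\Rightarrow A,\Lambda$. -/

import Mathlib

/-- Groups: nonempty sets of agents (the set of agents is finite in the theorem). -/
abbrev Grp (Agent : Type*) := {G : Finset Agent // G.Nonempty}

/-- Formulas of the language of distributed knowledge; `box G α` is `D_G α`. -/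
inductive Form (Var Agent : Type*) : Type _
  | atom : Var → Form Var Agent
  | bot : Form Var Agent
  | and : Form Var Agent → Form Var Agent → Form Var Agent
  | or : Form Var Agent → Form Var Agent → Form Var Agent
  | imp : Form Var Agent → Form Var Agent → Form Var Agent
  | neg : Form Var Agent → Form Var Agent
  | box : Grp Agent → Form Var Agent → Form Var Agent

namespace Form

/-- The propositional variables occurring in a formula. -/
def vars {Var Agent : Type*} : Form Var Agent → Set Var
  | atom p => {p}
  | bot => ∅
  | and α β => vars α ∪ vars β
  | or α β => vars α ∪ vars β
  | imp α β => vars α ∪ vars β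
  | neg α => vars α
  | box _ α => vars α

/-- The agent symbols occurring in a formula. -/
def agents {Var Agent : Type*} : Form Var Agent → Set Agent
  | atom _ => ∅
  | bot => ∅
  | and α β => agents α ∪ agents β
  | or α β => agents α ∪ agents β
  | imp α β => agents α ∪ agents β
  | neg α => agents α
  | box G α => {a | a ∈ G.1} ∪ agents α

/-- Propositional variables and `⊥`. -/
def IsAtomic {Var Agent : Type*} (φ : Form Var Agent) : Prop :=
  φ = bot ∨ ∃ p, φ = atom p

/-- Outmost boxed formulas. -/
def IsBoxed {Var Agent : Type*} (φ : Form Var Agent) : Prop :=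
  ∃ G α, φ = box G α

/-- `G`-sub formulas: formulas `D_H β` with `H ⊆ G`. -/
def IsGSub {Var Agent : Type*} (G : Grp Agent) (φ : Form Var Agent) : Prop :=
  ∃ (H : Grp Agent) (β : Form Var Agent), H.1 ⊆ G.1 ∧ φ = box H β

/-- The propositional variables occurring in a multiset of formulas. -/
def multisetVars {Var Agent : Type*} (Γ : Multiset (Form Var Agent)) : Set Var :=
  {p | ∃ φ ∈ Γ, p ∈ φ.vars}

/-- The agent symbols occurring in a multiset of formulas. -/
def multisetAgents {Var Agent : Type*} (Γ : Multiset (Form Var Agent)) : Set Agent :=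
  {a | ∃ φ ∈ Γ, a ∈ φ.agents}

end Form

/-- `KTPlus S Γ Δ`: the T-sequent `S | Γ ⇒ Δ` is derivable in `G(KT⁺_D)`. The condition on `S` in the
initial sequents makes every derivable triple a T-sequent (`S` holds outmost boxed formulas only). -/
inductive KTPlus {Var Agent : Type*} :
    Multiset (Form Var Agent) → Multiset (Form Var Agent) → Multiset (Form Var Agent) → Prop
  | init (S Γ Δ : Multiset (Form Var Agent)) (p : Var) (hS : ∀ σ ∈ S, σ.IsBoxed) :
      KTPlus S (Form.atom p ::ₘ Γ) (Form.atom p ::ₘ Δ)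
  | initBot (S Γ Δ : Multiset (Form Var Agent)) (hS : ∀ σ ∈ S, σ.IsBoxed) :
      KTPlus S (Form.bot ::ₘ Γ) Δ
  | andR {S Γ Δ : Multiset (Form Var Agent)} {α β : Form Var Agent} :
      KTPlus S Γ (α ::ₘ Δ) → KTPlus S Γ (β ::ₘ Δ) → KTPlus S Γ (Form.and α β ::ₘ Δ)
  | andL {S Γ Δ : Multiset (Form Var Agent)} {α β : Form Var Agent} :
      KTPlus S (α ::ₘ β ::ₘ Γ) Δ → KTPlus S (Form.and α β ::ₘ Γ) Δ
  | orR {S Γ Δ : Multiset (Form Var Agent)} {α β : Form Var Agent} :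
      KTPlus S Γ (α ::ₘ β ::ₘ Δ) → KTPlus S Γ (Form.or α β ::ₘ Δ)
  | orL {S Γ Δ : Multiset (Form Var Agent)} {α β : Form Var Agent} :
      KTPlus S (α ::ₘ Γ) Δ → KTPlus S (β ::ₘ Γ) Δ → KTPlus S (Form.or α β ::ₘ Γ) Δ
  | impR {S Γ Δ : Multiset (Form Var Agent)} {α β : Form Var Agent} :
      KTPlus S (α ::ₘ Γ) (β ::ₘ Δ) → KTPlus S Γ (Form.imp α β ::ₘ Δ)
  | impL {S Γ Δ : Multiset (Form Var Agent)} {α β : Form Var Agent} :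
      KTPlus S Γ (α ::ₘ Δ) → KTPlus S (β ::ₘ Γ) Δ → KTPlus S (Form.imp α β ::ₘ Γ) Δ
  | negR {S Γ Δ : Multiset (Form Var Agent)} {α : Form Var Agent} :
      KTPlus S (α ::ₘ Γ) Δ → KTPlus S Γ (Form.neg α ::ₘ Δ)
  | negL {S Γ Δ : Multiset (Form Var Agent)} {α : Form Var Agent} :
      KTPlus S Γ (α ::ₘ Δ) → KTPlus S (Form.neg α ::ₘ Γ) Δ
  /-- The rule `(D_K⁺)`: `M` lists the pairs `(G_i, α_i)` of the principal formulas `D_{G_i} α_i`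
  in the storage (it may be empty), `S` is the storage context. -/
  | boxK {S P Ω : Multiset (Form Var Agent)} {M : Multiset (Grp Agent × Form Var Agent)}
      {G : Grp Agent} {β : Form Var Agent}
      (hM : ∀ x ∈ M, x.1.1 ⊆ G.1)
      (hS : ∀ σ ∈ S, σ.IsBoxed ∧ ¬ σ.IsGSub G)
      (hP : ∀ φ ∈ P, φ.IsAtomic)
      (hΩ : ∀ φ ∈ Ω, φ.IsAtomic ∨ φ.IsBoxed) :
      KTPlus 0 (M.map Prod.snd) {β} →
      KTPlus (S + M.map fun x => Form.box x.1 x.2) P (Form.box G β ::ₘ Ω)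
  /-- The rule `(D_T⁺)`. -/
  | boxT {S Γ Δ : Multiset (Form Var Agent)} {G : Grp Agent} {α : Form Var Agent} :
      KTPlus (Form.box G α ::ₘ S) (α ::ₘ Γ) Δ → KTPlus S (Form.box G α ::ₘ Γ) Δ

/-!
The calculus has invertible rules for everything except `D_K⁺`, whose conclusion may contain, apart from
the storage, only propositional variables, `⊥` and, on the right, boxed formulas ("critical" formulas).
To treat the invertible rules uniformly, sequents are written with signed formulas (`SForm`): `SForm.red`
lists the premisses of the rule for a principal formula, and `Der` is the resulting calculus, equivalent
to `KTPlus` (`Der.of_ktPlus`, `Der.toKTPlus`). Only weakening (`Der.weaken_cons`) and invertibility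
(`Der.invert`) are needed; neither contraction nor cut is.

An interpolant of `S | X` is found by recursion on the modal depth and, for a fixed depth, on the size of
`X` (`exists_isInterpolant`). Moving `D_G α` to the storage makes `X` smaller, and the storage matters
again only in `D_K⁺`, where the depth drops.

* If some formula of `X` can be decomposed, the interpolant is the conjunction of the interpolants of the
  premisses (`exists_isInterpolant_cons`).
* If `X` is critical and `S | X` is derivable, the interpolant is `⊤`.
* Otherwise it is a finite disjunction with one disjunct for each way in which `X` or `S` can take part in
  the last relevant inference of a derivation of `T, S | Z, X`, where `p` and `a` do not occur in `T`, `Z`: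
  a literal for an axiom; `D_{G ∖ {a}} A'` for `D_K⁺` with principal formula `D_G β` in `X`
  (`exists_covers_box_mem`), since the formulas coming from `T` have groups without `a`; and
  `¬ D_{G'} ¬ A'` for `D_K⁺` with principal formula `D_G β` in `Z` (`exists_covers_group`), where `G'`
  consists of the agents of `G` that occur in `S`. Replacing `G` by `G'` keeps the agents of the
  interpolant among those of the sequent, and leaves finitely many cases.

The interpolant is shown to satisfy `T | Z ⇒ A`, from which the version with `T` in the antecedent follows
by weakening and `D_T⁺` (`Der.unstore`).
-/

section Interpolation

variable {Var Agent : Type*}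

/-! ### Formulas and signed formulas -/

/-- A formula together with the side of the sequent on which it stands. A sequent `S | Γ ⇒ Δ` becomes
a storage `S` with one multiset of signed formulas. -/
inductive SForm (Var Agent : Type*) : Type _
  | left : Form Var Agent → SForm Var Agent
  | right : Form Var Agent → SForm Var Agent

namespace Form

/-- The number of symbols of a formula. -/
def size : Form Var Agent → ℕ
  | atom _ => 1
  | bot => 1
  | and α β => size α + size β + 1
  | or α β => size α + size β + 1
  | imp α β => size α + size β + 1
  | neg α => size α + 1
  | box _ α => size α + 1

/-- The modal depth of a formula. -/
def depth : Form Var Agent → ℕ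
  | atom _ => 0
  | bot => 0
  | and α β => max (depth α) (depth β)
  | or α β => max (depth α) (depth β)
  | imp α β => max (depth α) (depth β)
  | neg α => depth α
  | box _ α => depth α + 1

/-- Every variable and every agent of `φ` occurs in `ψ`. -/
def SymLE (φ ψ : Form Var Agent) : Prop :=
  φ.vars ⊆ ψ.vars ∧ φ.agents ⊆ ψ.agents

/-- Neither the variable `p` nor the agent `a` occurs in `φ`. -/
def Fresh (p : Var) (a : Agent) (φ : Form Var Agent) : Prop :=
  p ∉ φ.vars ∧ a ∉ φ.agents

lemma Fresh.mono {p : Var} {a : Agent} {φ ψ : Form Var Agent} (h : Fresh p a ψ)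
    (hle : φ.SymLE ψ) : Fresh p a φ :=
  ⟨fun hp => h.1 (hle.1 hp), fun ha => h.2 (hle.2 ha)⟩

/-- Every symbol of `A` occurs in `X`, and neither `p` nor `a` occurs in `A`. -/
def Over (p : Var) (a : Agent) (X : Multiset (Form Var Agent)) (A : Form Var Agent) : Prop :=
  A.vars ⊆ multisetVars X \ {p} ∧ A.agents ⊆ multisetAgents X \ {a}

lemma Over.mono {p : Var} {a : Agent} {X X' : Multiset (Form Var Agent)} {A : Form Var Agent}
    (h : Over p a X A) (hle : ∀ φ ∈ X, ∃ ψ ∈ X', φ.SymLE ψ) : Over p a X' A := by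
  refine ⟨fun q hq => ?_, fun b hb => ?_⟩
  · obtain ⟨⟨φ, hφ, hqφ⟩, hqp⟩ := h.1 hq
    obtain ⟨ψ, hψ, hle⟩ := hle φ hφ
    exact ⟨⟨ψ, hψ, hle.1 hqφ⟩, hqp⟩
  · obtain ⟨⟨φ, hφ, hbφ⟩, hba⟩ := h.2 hb
    obtain ⟨ψ, hψ, hle⟩ := hle φ hφ
    exact ⟨⟨ψ, hψ, hle.2 hbφ⟩, hba⟩

lemma over_bot (p : Var) (a : Agent) (X : Multiset (Form Var Agent)) : Over p a X bot :=
  ⟨Set.empty_subset _, Set.empty_subset _⟩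

lemma Over.neg {p : Var} {a : Agent} {X : Multiset (Form Var Agent)} {A : Form Var Agent}
    (h : Over p a X A) : Over p a X A.neg := h

lemma Over.and {p : Var} {a : Agent} {X : Multiset (Form Var Agent)} {A B : Form Var Agent}
    (hA : Over p a X A) (hB : Over p a X B) : Over p a X (A.and B) :=
  ⟨Set.union_subset hA.1 hB.1, Set.union_subset hA.2 hB.2⟩

lemma Over.or {p : Var} {a : Agent} {X : Multiset (Form Var Agent)} {A B : Form Var Agent}
    (hA : Over p a X A) (hB : Over p a X B) : Over p a X (A.or B) := hA.and hB

lemma over_atom {p q : Var} (a : Agent) {X : Multiset (Form Var Agent)} (hX : atom q ∈ X)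
    (hq : q ≠ p) : Over p a X (atom q) := by
  refine ⟨?_, Set.empty_subset _⟩
  rintro _ rfl
  exact ⟨⟨_, hX, rfl⟩, hq⟩

lemma Over.box {p : Var} {a : Agent} {X : Multiset (Form Var Agent)} {A : Form Var Agent}
    (h : Over p a X A) {G : Grp Agent} (hG : ∀ b ∈ G.1, b ∈ multisetAgents X) (ha : a ∉ G.1) :
    Over p a X (box G A) := by
  refine ⟨h.1, Set.union_subset (fun b hb => ⟨hG b hb, ?_⟩) h.2⟩
  rintro rfl
  exact ha hb

end Form

namespace SForm

/-- The underlying formula. -/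
def form : SForm Var Agent → Form Var Agent
  | left φ => φ
  | right φ => φ

/-- The signed formulas to which no rule other than `(D_K⁺)` applies: propositional variables and
`⊥` on both sides, and outmost boxed formulas on the right. -/
def IsCrit : SForm Var Agent → Prop
  | left φ => φ.IsAtomic
  | right φ => φ.IsAtomic ∨ φ.IsBoxed

/-- The premisses of the rule, other than `(D_K⁺)`, with principal formula `x`: each is given by the
formulas added to the storage and the signed formulas that replace `x`. The value at critical formulas
is a junk value. -/
def red : SForm Var Agent → List (Multiset (Form Var Agent) × Multiset (SForm Var Agent))
  | left (.and α β) => [(0, {left α, left β})]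
  | left (.or α β) => [(0, {left α}), (0, {left β})]
  | left (.imp α β) => [(0, {right α}), (0, {left β})]
  | left (.neg α) => [(0, {right α})]
  | left (.box G α) => [({.box G α}, {left α})]
  | right (.and α β) => [(0, {right α}), (0, {right β})]
  | right (.or α β) => [(0, {right α, right β})]
  | right (.imp α β) => [(0, {left α, right β})]
  | right (.neg α) => [(0, {left α})]
  | _ => []

/-- The total size of a multiset of signed formulas. -/
def weight (X : Multiset (SForm Var Agent)) : ℕ := (X.map fun x => x.form.size).sum

lemma weight_add (X Y : Multiset (SForm Var Agent)) : weight (X + Y) = weight X + weight Y := by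
  simp [weight]

lemma weight_cons (x : SForm Var Agent) (X : Multiset (SForm Var Agent)) :
    weight (x ::ₘ X) = x.form.size + weight X := by
  simp [weight]

lemma weight_red {x : SForm Var Agent} {y} (hy : y ∈ red x) : weight y.2 < x.form.size := by
  rcases x with (_ | _ | _ | _ | _ | _ | _) | (_ | _ | _ | _ | _ | _ | _) <;>
    simp only [red, List.mem_cons, List.not_mem_nil, or_false] at hy <;>
    rcases hy with rfl | rfl <;> simp +arith [weight, form, Form.size]

lemma size_lt_of_mem_red {x : SForm Var Agent} {y} (hy : y ∈ red x) {z} (hz : z ∈ y.2) :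
    z.form.size < x.form.size :=
  lt_of_le_of_lt (Multiset.single_le_sum (fun _ _ => Nat.zero_le _) _
    (Multiset.mem_map_of_mem (fun z : SForm Var Agent => z.form.size) hz)) (weight_red hy)

lemma storage_red {x : SForm Var Agent} {y} (hy : y ∈ red x) {σ} (hσ : σ ∈ y.1) :
    σ = x.form ∧ ∃ G α, σ = .box G α := by
  rcases x with (_ | _ | _ | _ | _ | _ | _) | (_ | _ | _ | _ | _ | _ | _) <;>
    simp only [red, List.mem_cons, List.not_mem_nil, or_false] at hy <;>
    rcases hy with rfl | rfl <;> simp at hσ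
  simp [hσ, form]

lemma symLE_red {x : SForm Var Agent} {y} (hy : y ∈ red x) {z} (hz : z ∈ y.2) :
    z.form.SymLE x.form ∧ z.form.depth ≤ x.form.depth := by
  rcases x with (_ | _ | _ | _ | _ | _ | _) | (_ | _ | _ | _ | _ | _ | _) <;>
    simp only [red, List.mem_cons, List.not_mem_nil, or_false] at hy <;>
    first
    | (rcases hy with rfl | rfl <;> simp at hz <;> subst hz <;>
        simp [form, Form.SymLE, Form.vars, Form.agents, Form.depth])
    | (subst hy; simp at hz; rcases hz with rfl | rfl <;>
        simp [form, Form.SymLE, Form.vars, Form.agents, Form.depth])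

end SForm

/-! ### The signed calculus -/

open Classical in
/-- The multiset of all `α` with `D_H α` in `S` and `H ⊆ G`. -/
noncomputable def body (G : Grp Agent) (S : Multiset (Form Var Agent)) : Multiset (Form Var Agent) :=
  S.filterMap fun
    | .box H α => if H.1 ⊆ G.1 then some α else none
    | _ => none

lemma body_add (G : Grp Agent) (S T : Multiset (Form Var Agent)) :
    body G (S + T) = body G S + body G T := by
  simp [body, Multiset.filterMap_add]

lemma body_cons_of_subset {G H : Grp Agent} (h : H.1 ⊆ G.1) (α : Form Var Agent)
    (S : Multiset (Form Var Agent)) : body G (.box H α ::ₘ S) = α ::ₘ body G S := by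
  rw [body, Multiset.filterMap_cons_some (b := α)]
  · rfl
  · simp [h]

lemma body_cons_of_not_subset {G H : Grp Agent} (h : ¬ H.1 ⊆ G.1) (α : Form Var Agent)
    (S : Multiset (Form Var Agent)) : body G (.box H α ::ₘ S) = body G S := by
  rw [body, Multiset.filterMap_cons_none]
  · rfl
  · simp [h]

lemma mem_body {G : Grp Agent} {S : Multiset (Form Var Agent)} {α : Form Var Agent} :
    α ∈ body G S ↔ ∃ H : Grp Agent, H.1 ⊆ G.1 ∧ Form.box H α ∈ S := by
  classical
  simp only [body, Multiset.mem_filterMap]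
  constructor
  · rintro ⟨φ, hφ, h⟩
    cases φ <;> simp at h
    obtain ⟨h, rfl⟩ := h
    exact ⟨_, h, hφ⟩
  · rintro ⟨H, h, hS⟩
    exact ⟨_, hS, by simp [h]⟩

/-- The body depends only on which groups occurring in `S` are below `G`. -/
lemma body_congr {G G' : Grp Agent} {S : Multiset (Form Var Agent)}
    (h : ∀ H α, Form.box H α ∈ S → (H.1 ⊆ G.1 ↔ H.1 ⊆ G'.1)) : body G S = body G' S := by
  induction S using Multiset.induction_on with
  | empty => rfl
  | cons φ S ih =>
    have ih := ih fun H α hH => h H α (Multiset.mem_cons_of_mem hH)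
    have hφ := fun H α (e : Form.box H α = φ) => h H α (e ▸ Multiset.mem_cons_self _ _)
    rw [← Multiset.singleton_add, body_add, body_add, ih]
    cases φ with
    | box H α =>
      congr 1
      have := hφ H α rfl
      by_cases hH : H.1 ⊆ G.1
      · rw [← Multiset.cons_zero, body_cons_of_subset hH, body_cons_of_subset (this.1 hH)]
        rfl
      · rw [← Multiset.cons_zero, body_cons_of_not_subset hH,
          body_cons_of_not_subset (mt this.2 hH)]
        rfl
    | _ => rfl

lemma symLE_of_mem_body {G : Grp Agent} {S : Multiset (Form Var Agent)} {α : Form Var Agent}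
    (h : α ∈ body G S) : ∃ σ ∈ S, α.SymLE σ ∧ α.depth < σ.depth := by
  obtain ⟨H, -, hS⟩ := mem_body.1 h
  exact ⟨_, hS, ⟨subset_rfl, Set.subset_union_right⟩, Nat.lt_succ_self _⟩

/-- The calculus `G(KT⁺_D)` on signed sequents: all invertible rules are instances of `rule`, and the
storage formulas on which `(D_K⁺)` acts are read off from the group of its principal formula. -/
inductive Der : Multiset (Form Var Agent) → Multiset (SForm Var Agent) → Prop
  | init {S X} (q : Var) (hS : ∀ σ ∈ S, Form.IsBoxed σ) (hl : SForm.left (.atom q) ∈ X)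
      (hr : SForm.right (.atom q) ∈ X) : Der S X
  | initBot {S X} (hS : ∀ σ ∈ S, Form.IsBoxed σ) (hl : SForm.left .bot ∈ X) : Der S X
  | rule {S X} (x : SForm Var Agent) (hx : ¬ x.IsCrit)
      (h : ∀ y ∈ x.red, Der (y.1 + S) (y.2 + X)) : Der S (x ::ₘ X)
  | boxK {S X} (G : Grp Agent) (β : Form Var Agent) (hS : ∀ σ ∈ S, Form.IsBoxed σ)
      (hX : ∀ x ∈ X, SForm.IsCrit x) (hr : SForm.right (.box G β) ∈ X)
      (h : Der 0 (SForm.right β ::ₘ (body G S).map .left)) : Der S X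

namespace Der

open SForm

variable {S T : Multiset (Form Var Agent)} {X : Multiset (SForm Var Agent)}

lemma weaken_crit {x : SForm Var Agent} (hx : x.IsCrit) (h : Der S X) : Der S (x ::ₘ X) := by
  induction h with
  | init q hS hl hr =>
    exact init q hS (Multiset.mem_cons_of_mem hl) (Multiset.mem_cons_of_mem hr)
  | initBot hS hl => exact initBot hS (Multiset.mem_cons_of_mem hl)
  | rule z hz _ ih =>
    rw [Multiset.cons_swap]
    refine rule z hz fun y hy => ?_
    rw [Multiset.add_cons]
    exact ih y hy
  | boxK G β hS hX hr h _ =>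
    refine boxK G β hS ?_ (Multiset.mem_cons_of_mem hr) h
    simpa using ⟨hx, hX⟩

lemma weaken_storage_of {G : Grp Agent} {α : Form Var Agent}
    (hα : ∀ {S X}, Der S X → Der S (left α ::ₘ X)) (h : Der S X) : Der (.box G α ::ₘ S) X := by
  have hbox : ∀ {S : Multiset (Form Var Agent)}, (∀ σ ∈ S, Form.IsBoxed σ) →
      ∀ σ ∈ Form.box G α ::ₘ S, Form.IsBoxed σ := fun hS => by
    simpa using ⟨⟨G, α, rfl⟩, hS⟩
  induction h with
  | init q hS hl hr => exact init q (hbox hS) hl hr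
  | initBot hS hl => exact initBot (hbox hS) hl
  | rule z hz _ ih =>
    refine rule z hz fun y hy => ?_
    rw [Multiset.add_cons]
    exact ih y hy
  | boxK H β hS hX hr h _ =>
    refine boxK H β (hbox hS) hX hr ?_
    by_cases hGH : G.1 ⊆ H.1
    · rw [body_cons_of_subset hGH, Multiset.map_cons, Multiset.cons_swap]
      exact hα h
    · rwa [body_cons_of_not_subset hGH]

/-- Weakening. A formula to which an invertible rule applies is decomposed by that rule, so that only
smaller formulas have to be added; a critical one is carried through the derivation. -/
lemma weaken_cons (x : SForm Var Agent) (h : Der S X) : Der S (x ::ₘ X) := by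
  induction hn : x.form.size using Nat.strong_induction_on generalizing x S X with
  | _ n ih =>
  subst hn
  by_cases hx : x.IsCrit
  · exact weaken_crit hx h
  refine rule x hx fun y hy => ?_
  have key : ∀ Z : Multiset (SForm Var Agent), Z ≤ y.2 → Der S (Z + X) := by
    intro Z
    induction Z using Multiset.induction_on with
    | empty => intro _; simpa using h
    | cons z Z ihZ =>
      intro hle
      rw [Multiset.cons_add]
      exact ih _ (size_lt_of_mem_red hy (Multiset.subset_of_le hle (Multiset.mem_cons_self z Z))) z
        (ihZ ((Multiset.le_cons_self _ _).trans hle)) rfl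
  have key' : ∀ U : Multiset (Form Var Agent), U ≤ y.1 → Der (U + S) (y.2 + X) := by
    intro U
    induction U using Multiset.induction_on with
    | empty => intro _; simpa using key _ le_rfl
    | cons σ U ihU =>
      intro hle
      obtain ⟨hσx, G, α, rfl⟩ :=
        storage_red hy (Multiset.subset_of_le hle (Multiset.mem_cons_self σ U))
      rw [Multiset.cons_add]
      refine weaken_storage_of (fun h => ih _ ?_ (left α) h rfl)
        (ihU ((Multiset.le_cons_self _ _).trans hle))
      rw [← hσx]
      exact Nat.lt_succ_self _
  exact key' _ le_rfl

/-- Every rule other than `(D_K⁺)` is invertible. -/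
lemma invert {x : SForm Var Agent} (hx : ¬ x.IsCrit) {y} (hy : y ∈ x.red)
    (h : Der S (x ::ₘ X)) : Der (y.1 + S) (y.2 + X) := by
  have hbox : ∀ {S : Multiset (Form Var Agent)}, (∀ σ ∈ S, Form.IsBoxed σ) →
      ∀ σ ∈ y.1 + S, Form.IsBoxed σ := fun hS σ hσ =>
    (Multiset.mem_add.1 hσ).elim (fun h => (storage_red hy h).2) (hS σ)
  have hmem : ∀ {z : SForm Var Agent} {X}, z.IsCrit → z ∈ x ::ₘ X → z ∈ y.2 + X := by
    intro z X hz h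
    rcases Multiset.mem_cons.1 h with rfl | h
    · exact absurd hz hx
    · exact Multiset.mem_add.2 (.inr h)
  generalize hW : x ::ₘ X = W at h
  induction h generalizing X with
  | init q hS hl hr =>
    subst hW
    exact init q (hbox hS) (hmem (.inr ⟨q, rfl⟩) hl) (hmem (.inl (.inr ⟨q, rfl⟩)) hr)
  | initBot hS hl =>
    subst hW
    exact initBot (hbox hS) (hmem (.inl rfl) hl)
  | @rule S Z z hz hprem ih =>
    rcases Multiset.cons_eq_cons.1 hW with ⟨rfl, rfl⟩ | ⟨-, C, rfl, rfl⟩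
    · exact hprem y hy
    · rw [Multiset.add_cons]
      refine rule z hz fun u hu => ?_
      rw [add_left_comm, add_left_comm u.2]
      exact ih u hu (by rw [Multiset.add_cons])
  | boxK G β hS hX hr h _ =>
    subst hW
    exact absurd (hX x (Multiset.mem_cons_self _ _)) hx

/-- Formulas of the storage may be moved to the antecedent. -/
lemma unstore (hT : ∀ θ ∈ T, Form.IsBoxed θ) (h : Der (T + S) X) : Der S (T.map left + X) := by
  induction T using Multiset.induction_on generalizing S with
  | empty => simpa using h
  | cons θ T ih =>
    obtain ⟨G, α, rfl⟩ := hT θ (Multiset.mem_cons_self _ _)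
    rw [Multiset.map_cons, Multiset.cons_add]
    refine rule _ (by simp [IsCrit, Form.IsAtomic]) fun y hy => ?_
    simp only [red, List.mem_singleton] at hy
    subst hy
    simp only [Multiset.singleton_add]
    refine weaken_cons _ (ih (fun θ hθ => hT θ (Multiset.mem_cons_of_mem hθ)) ?_)
    rwa [Multiset.add_cons, ← Multiset.cons_add]

/-! #### Instances of the rules -/

lemma andL {α β : Form Var Agent} (h : Der S (left α ::ₘ left β ::ₘ X)) :
    Der S (left (.and α β) ::ₘ X) :=
  rule _ (by simp [IsCrit, Form.IsAtomic]) (by simpa [red] using h)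

lemma andR {α β : Form Var Agent} (hα : Der S (right α ::ₘ X)) (hβ : Der S (right β ::ₘ X)) :
    Der S (right (.and α β) ::ₘ X) :=
  rule _ (by simp [IsCrit, Form.IsAtomic, Form.IsBoxed]) (by simpa [red] using ⟨hα, hβ⟩)

lemma orL {α β : Form Var Agent} (hα : Der S (left α ::ₘ X)) (hβ : Der S (left β ::ₘ X)) :
    Der S (left (.or α β) ::ₘ X) :=
  rule _ (by simp [IsCrit, Form.IsAtomic]) (by simpa [red] using ⟨hα, hβ⟩)

lemma orR {α β : Form Var Agent} (h : Der S (right α ::ₘ right β ::ₘ X)) :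
    Der S (right (.or α β) ::ₘ X) :=
  rule _ (by simp [IsCrit, Form.IsAtomic, Form.IsBoxed]) (by simpa [red] using h)

lemma impL {α β : Form Var Agent} (hα : Der S (right α ::ₘ X)) (hβ : Der S (left β ::ₘ X)) :
    Der S (left (.imp α β) ::ₘ X) :=
  rule _ (by simp [IsCrit, Form.IsAtomic]) (by simpa [red] using ⟨hα, hβ⟩)

lemma impR {α β : Form Var Agent} (h : Der S (left α ::ₘ right β ::ₘ X)) :
    Der S (right (.imp α β) ::ₘ X) :=
  rule _ (by simp [IsCrit, Form.IsAtomic, Form.IsBoxed]) (by simpa [red] using h)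

lemma negL {α : Form Var Agent} (h : Der S (right α ::ₘ X)) : Der S (left (.neg α) ::ₘ X) :=
  rule _ (by simp [IsCrit, Form.IsAtomic]) (by simpa [red] using h)

lemma negR {α : Form Var Agent} (h : Der S (left α ::ₘ X)) : Der S (right (.neg α) ::ₘ X) :=
  rule _ (by simp [IsCrit, Form.IsAtomic, Form.IsBoxed]) (by simpa [red] using h)

lemma boxT {G : Grp Agent} {α : Form Var Agent} (h : Der (.box G α ::ₘ S) (left α ::ₘ X)) :
    Der S (left (.box G α) ::ₘ X) :=
  rule _ (by simp [IsCrit, Form.IsAtomic]) (by simpa [red] using h)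

lemma top (hS : ∀ σ ∈ S, Form.IsBoxed σ) : Der S (right (.neg .bot) ::ₘ X) :=
  negR (initBot hS (Multiset.mem_cons_self _ _))

end Der

namespace Der

open SForm

variable {S : Multiset (Form Var Agent)} {X : Multiset (SForm Var Agent)}

/-! ### Equivalence of the two calculi -/

/-- The signed version of the part `Γ ⇒ Δ` of a sequent. -/
def sign (Γ Δ : Multiset (Form Var Agent)) : Multiset (SForm Var Agent) :=
  Γ.map left + Δ.map right

lemma sign_cons_left (φ : Form Var Agent) (Γ Δ : Multiset (Form Var Agent)) :
    sign (φ ::ₘ Γ) Δ = left φ ::ₘ sign Γ Δ := by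
  simp [sign]

lemma sign_cons_right (φ : Form Var Agent) (Γ Δ : Multiset (Form Var Agent)) :
    sign Γ (φ ::ₘ Δ) = right φ ::ₘ sign Γ Δ := by
  simp [sign]

lemma exists_sign (X : Multiset (SForm Var Agent)) : ∃ Γ Δ, X = sign Γ Δ := by
  induction X using Multiset.induction_on with
  | empty => exact ⟨0, 0, rfl⟩
  | cons x X ih =>
    obtain ⟨Γ, Δ, rfl⟩ := ih
    cases x with
    | left φ => exact ⟨φ ::ₘ Γ, Δ, (sign_cons_left ..).symm⟩
    | right φ => exact ⟨Γ, φ ::ₘ Δ, (sign_cons_right ..).symm⟩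

lemma left_mem_sign {φ : Form Var Agent} {Γ Δ : Multiset (Form Var Agent)} :
    left φ ∈ sign Γ Δ ↔ φ ∈ Γ := by
  simp [sign]

lemma right_mem_sign {φ : Form Var Agent} {Γ Δ : Multiset (Form Var Agent)} :
    right φ ∈ sign Γ Δ ↔ φ ∈ Δ := by
  simp [sign]

lemma sign_inj {Γ Δ Γ' Δ' : Multiset (Form Var Agent)} (h : sign Γ Δ = sign Γ' Δ') :
    Γ = Γ' ∧ Δ = Δ' := by
  classical
  have hl : ∀ φ ψ : Form Var Agent, left φ = left ψ → φ = ψ := fun _ _ => SForm.left.inj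
  have hr : ∀ φ ψ : Form Var Agent, right φ = right ψ → φ = ψ := fun _ _ => SForm.right.inj
  constructor <;> ext φ
  · have := congrArg (Multiset.count (left φ)) h
    simpa [sign, Multiset.count_map_eq_count' left _ (fun _ _ => hl _ _),
      Multiset.count_eq_zero_of_notMem] using this
  · have := congrArg (Multiset.count (right φ)) h
    simpa [sign, Multiset.count_map_eq_count' right _ (fun _ _ => hr _ _),
      Multiset.count_eq_zero_of_notMem] using this

lemma body_eq_zero {G : Grp Agent} (hS : ∀ σ ∈ S, Form.IsBoxed σ ∧ ¬ Form.IsGSub G σ) :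
    body G S = 0 := by
  refine Multiset.eq_zero_of_forall_notMem fun α hα => ?_
  obtain ⟨H, hH, hS'⟩ := mem_body.1 hα
  exact (hS _ hS').2 ⟨H, α, hH, rfl⟩

lemma body_map_box {G : Grp Agent} {M : Multiset (Grp Agent × Form Var Agent)}
    (hM : ∀ x ∈ M, x.1.1 ⊆ G.1) :
    body G (M.map fun x => Form.box x.1 x.2) = M.map Prod.snd := by
  induction M using Multiset.induction_on with
  | empty => rfl
  | cons x M ih =>
    rw [Multiset.map_cons, body_cons_of_subset (hM x (Multiset.mem_cons_self _ _)),
      ih fun y hy => hM y (Multiset.mem_cons_of_mem hy), Multiset.map_cons]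

/-- A storage splits into its `G`-sub formulas and the remaining formulas. -/
lemma exists_split (G : Grp Agent) (hS : ∀ σ ∈ S, Form.IsBoxed σ) :
    ∃ (S' : Multiset (Form Var Agent)) (M : Multiset (Grp Agent × Form Var Agent)),
      S = S' + M.map (fun x => Form.box x.1 x.2) ∧ (∀ x ∈ M, x.1.1 ⊆ G.1) ∧
        ∀ σ ∈ S', Form.IsBoxed σ ∧ ¬ Form.IsGSub G σ := by
  induction S using Multiset.induction_on with
  | empty => exact ⟨0, 0, by simp⟩
  | cons σ S ih =>
    obtain ⟨S', M, rfl, hM, hS'⟩ := ih fun τ hτ => hS τ (Multiset.mem_cons_of_mem hτ)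
    by_cases hσ : σ.IsGSub G
    · obtain ⟨H, α, hH, rfl⟩ := hσ
      exact ⟨S', (H, α) ::ₘ M, by simp, by simpa using ⟨hH, fun a ha b => hM (⟨a, ha⟩, b)⟩, hS'⟩
    · exact ⟨σ ::ₘ S', M, by simp, hM, by simpa [hσ] using ⟨hS σ (by simp), hS'⟩⟩

lemma of_ktPlus {Γ Δ : Multiset (Form Var Agent)} (h : KTPlus S Γ Δ) : Der S (sign Γ Δ) := by
  induction h with
  | init S Γ Δ q hS =>
    exact init q hS (left_mem_sign.2 (Multiset.mem_cons_self _ _))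
      (right_mem_sign.2 (Multiset.mem_cons_self _ _))
  | initBot S Γ Δ hS => exact initBot hS (left_mem_sign.2 (Multiset.mem_cons_self _ _))
  | andR _ _ ihα ihβ =>
    rw [sign_cons_right] at *
    exact andR ihα ihβ
  | andL _ ih =>
    rw [sign_cons_left] at *
    rw [sign_cons_left] at ih
    exact andL ih
  | orR _ ih =>
    rw [sign_cons_right] at *
    rw [sign_cons_right] at ih
    exact orR ih
  | orL _ _ ihα ihβ =>
    rw [sign_cons_left] at *
    exact orL ihα ihβ
  | impR _ ih =>
    rw [sign_cons_left, sign_cons_right] at ih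
    rw [sign_cons_right]
    exact impR ih
  | impL _ _ ihα ihβ =>
    rw [sign_cons_right] at ihα
    rw [sign_cons_left] at *
    exact impL ihα ihβ
  | negR _ ih =>
    rw [sign_cons_left] at ih
    rw [sign_cons_right]
    exact negR ih
  | negL _ ih =>
    rw [sign_cons_right] at ih
    rw [sign_cons_left]
    exact negL ih
  | @boxK S P Ω M G β hM hS hP hΩ _ ih =>
    refine boxK G β ?_ ?_ (right_mem_sign.2 (Multiset.mem_cons_self _ _)) ?_
    · intro σ hσ
      rcases Multiset.mem_add.1 hσ with hσ | hσ
      · exact (hS σ hσ).1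
      · obtain ⟨x, -, rfl⟩ := Multiset.mem_map.1 hσ
        exact ⟨_, _, rfl⟩
    · intro x hx
      cases x with
      | left φ => exact hP φ (left_mem_sign.1 hx)
      | right φ =>
        rcases Multiset.mem_cons.1 (right_mem_sign.1 hx) with rfl | hφ
        · exact .inr ⟨_, _, rfl⟩
        · exact hΩ φ hφ
    · rw [body_add, body_eq_zero hS, body_map_box hM, zero_add]
      rwa [← Multiset.cons_zero, sign_cons_right, sign, Multiset.map_zero, add_zero] at ih
  | boxT _ ih =>
    rw [sign_cons_left] at *
    exact boxT ih

lemma toKTPlus (h : Der S X) : ∀ {Γ Δ}, X = sign Γ Δ → KTPlus S Γ Δ := by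
  induction h with
  | init q hS hl hr =>
    rintro Γ Δ rfl
    obtain ⟨Γ, rfl⟩ := Multiset.exists_cons_of_mem (left_mem_sign.1 hl)
    obtain ⟨Δ, rfl⟩ := Multiset.exists_cons_of_mem (right_mem_sign.1 hr)
    exact .init _ _ _ _ hS
  | initBot hS hl =>
    rintro Γ Δ rfl
    obtain ⟨Γ, rfl⟩ := Multiset.exists_cons_of_mem (left_mem_sign.1 hl)
    exact .initBot _ _ _ hS
  | @rule S X x hx _ ih =>
    obtain ⟨Γ, Δ, rfl⟩ := exists_sign X
    cases x with
    | left φ =>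
      intro Γ' Δ' he
      rw [← sign_cons_left] at he
      obtain ⟨rfl, rfl⟩ := sign_inj he
      cases φ with
      | atom q => exact absurd (.inr ⟨q, rfl⟩) hx
      | bot => exact absurd (.inl rfl) hx
      | _ =>
        simp only [red, List.mem_cons, List.not_mem_nil, or_false, forall_eq_or_imp, forall_eq,
            zero_add, Multiset.insert_eq_cons, Multiset.cons_add, Multiset.singleton_add,
            ← sign_cons_left, ← sign_cons_right] at ih
        first
        | exact .andL (ih rfl)
        | exact .orL (ih.1 rfl) (ih.2 rfl)
        | exact .impL (ih.1 rfl) (ih.2 rfl)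
        | exact .negL (ih rfl)
        | exact .boxT (ih rfl)
    | right φ =>
      intro Γ' Δ' he
      rw [← sign_cons_right] at he
      obtain ⟨rfl, rfl⟩ := sign_inj he
      cases φ with
      | atom q => exact absurd (.inl (.inr ⟨q, rfl⟩)) hx
      | bot => exact absurd (.inl (.inl rfl)) hx
      | box G α => exact absurd (.inr ⟨_, _, rfl⟩) hx
      | _ =>
        simp only [red, List.mem_cons, List.not_mem_nil, or_false, forall_eq_or_imp, forall_eq,
            zero_add, Multiset.insert_eq_cons, Multiset.cons_add, Multiset.singleton_add,
            ← sign_cons_left, ← sign_cons_right] at ih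
        first
        | exact .andR (ih.1 rfl) (ih.2 rfl)
        | exact .orR (ih rfl)
        | exact .impR (ih rfl)
        | exact .negR (ih rfl)
  | boxK G β hS hX hr _ ih =>
    rintro Γ Δ rfl
    obtain ⟨Δ, rfl⟩ := Multiset.exists_cons_of_mem (right_mem_sign.1 hr)
    obtain ⟨S', M, rfl, hM, hS'⟩ := exists_split G hS
    refine .boxK hM hS' (fun φ hφ => hX _ (left_mem_sign.2 hφ))
      (fun φ hφ => hX _ (right_mem_sign.2 (Multiset.mem_cons_of_mem hφ))) (ih ?_)
    rw [body_add, body_eq_zero hS', body_map_box hM]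
    simp [sign, add_comm _ {right β}]

end Der

/-! ### Interpolants -/

open SForm

variable {p : Var} {a : Agent} {S : Multiset (Form Var Agent)} {X : Multiset (SForm Var Agent)}

/-- A context `T | Z` to which an interpolant has to react: `T` is a storage, and neither `p` nor `a`
occurs in `T` or `Z`. -/
structure IsContext (p : Var) (a : Agent) (T : Multiset (Form Var Agent))
    (Z : Multiset (SForm Var Agent)) : Prop where
  boxed : ∀ θ ∈ T, Form.IsBoxed θ
  fresh_storage : ∀ θ ∈ T, Form.Fresh p a θ
  fresh : ∀ z ∈ Z, Form.Fresh p a (SForm.form z)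

/-- `A` follows in every context that satisfies `C`. -/
def Covers (p : Var) (a : Agent)
    (C : Multiset (Form Var Agent) → Multiset (SForm Var Agent) → Prop) (A : Form Var Agent) : Prop :=
  ∀ T Z, IsContext p a T Z → C T Z → Der T (right A ::ₘ Z)

/-- `A` satisfies the first two requirements on an interpolant of the sequent `S | X`. -/
structure IsSound (p : Var) (a : Agent) (S : Multiset (Form Var Agent))
    (X : Multiset (SForm Var Agent)) (A : Form Var Agent) : Prop where
  syms : Form.Over p a (S + X.map form) A
  der : Der S (left A ::ₘ X)

/-- `A` is an interpolant of the sequent `S | X`. In the third requirement the storage of the context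
stays a storage, which makes the requirement stronger (see `Der.unstore`). -/
structure IsInterpolant (p : Var) (a : Agent) (S : Multiset (Form Var Agent))
    (X : Multiset (SForm Var Agent)) (A : Form Var Agent) : Prop extends IsSound p a S X A where
  covers : Covers p a (fun T Z => Der (T + S) (Z + X)) A

lemma IsSound.bot (hS : ∀ σ ∈ S, Form.IsBoxed σ) : IsSound p a S X .bot :=
  ⟨Form.over_bot _ _ _, .initBot hS (Multiset.mem_cons_self _ _)⟩

lemma IsSound.or {A B : Form Var Agent} (hA : IsSound p a S X A) (hB : IsSound p a S X B) :
    IsSound p a S X (A.or B) :=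
  ⟨hA.syms.or hB.syms, .orL hA.der hB.der⟩

/-- A finite disjunction of sound formulas covers everything that its members cover. -/
lemma exists_isSound_covers {ι : Type*} {s : Set ι} (hs : s.Finite) (hS : ∀ σ ∈ S, Form.IsBoxed σ)
    (C : ι → Multiset (Form Var Agent) → Multiset (SForm Var Agent) → Prop)
    (h : ∀ i ∈ s, ∃ A, IsSound p a S X A ∧ Covers p a (C i) A) :
    ∃ A, IsSound p a S X A ∧ ∀ i ∈ s, Covers p a (C i) A := by
  induction s, hs using Set.Finite.induction_on with
  | empty => exact ⟨.bot, .bot hS, by simp⟩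
  | @insert i s _ _ ih =>
    obtain ⟨A, hA, hAi⟩ := h i (Set.mem_insert _ _)
    obtain ⟨B, hB, hBs⟩ := ih fun j hj => h j (Set.mem_insert_of_mem _ hj)
    refine ⟨A.or B, hA.or hB, ?_⟩
    rintro j (rfl | hj) T Z hTZ hC
    · refine .orR ?_
      rw [Multiset.cons_swap]
      exact .weaken_cons _ (hAi T Z hTZ hC)
    · exact .orR (.weaken_cons _ (hBs j hj T Z hTZ hC))

/-- If the sequent is derivable, `⊤` is an interpolant. -/
lemma isInterpolant_top (h : Der S X) : IsInterpolant p a S X (.neg .bot) where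
  syms := (Form.over_bot _ _ _).neg
  der := .weaken_cons _ h
  covers _ _ hTZ _ := .top hTZ.boxed

/-! #### Sequents with a decomposable formula -/

/-- The conjunction of interpolants of the premisses of an invertible rule. -/
lemma exists_conj {U : Multiset (Form Var Agent)}
    (l : List (Multiset (Form Var Agent) × Multiset (SForm Var Agent)))
    (h : ∀ y ∈ l, ∃ A, Form.Over p a U A ∧ Der (y.1 + S) (left A ::ₘ (y.2 + X)) ∧
      Covers p a (fun T Z => Der (T + (y.1 + S)) (Z + (y.2 + X))) A) :
    ∃ A, Form.Over p a U A ∧ (∀ y ∈ l, Der (y.1 + S) (left A ::ₘ (y.2 + X))) ∧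
      Covers p a (fun T Z => ∀ y ∈ l, Der (T + (y.1 + S)) (Z + (y.2 + X))) A := by
  induction l with
  | nil =>
    exact ⟨.neg .bot, (Form.over_bot _ _ _).neg, by simp, fun T Z hTZ _ => .top hTZ.boxed⟩
  | cons y l ih =>
    obtain ⟨A, hA, hAd, hAc⟩ := h y (by simp)
    obtain ⟨B, hB, hBd, hBc⟩ := ih fun z hz => h z (List.mem_cons_of_mem _ hz)
    refine ⟨A.and B, hA.and hB, fun z hz => .andL ?_, fun T Z hTZ hC => .andR ?_ ?_⟩
    · rcases List.mem_cons.1 hz with rfl | hz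
      · rw [Multiset.cons_swap]
        exact .weaken_cons _ hAd
      · exact .weaken_cons _ (hBd z hz)
    · exact hAc T Z hTZ (hC y (by simp))
    · exact hBc T Z hTZ fun z hz => hC z (List.mem_cons_of_mem _ hz)

lemma exists_isInterpolant_cons {x : SForm Var Agent} (hx : ¬ x.IsCrit)
    (ih : ∀ y ∈ x.red, ∃ A, IsInterpolant p a (y.1 + S) (y.2 + X) A) :
    ∃ A, IsInterpolant p a S (x ::ₘ X) A := by
  obtain ⟨A, hA, hAd, hAc⟩ := exists_conj (p := p) (a := a) (S := S) (X := X)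
    (U := S + (x ::ₘ X).map form) x.red fun y hy => by
      obtain ⟨A, hA⟩ := ih y hy
      refine ⟨A, hA.syms.mono fun φ hφ => ?_, hA.der, hA.covers⟩
      simp only [Multiset.map_add, Multiset.mem_add, Multiset.mem_map] at hφ
      rcases hφ with (hφ | hφ) | ⟨z, hz, rfl⟩ | ⟨z, hz, rfl⟩
      · exact ⟨x.form, by simp, by rw [(storage_red hy hφ).1]; exact ⟨subset_rfl, subset_rfl⟩⟩
      · exact ⟨φ, by simp [hφ], subset_rfl, subset_rfl⟩
      · exact ⟨x.form, by simp, (symLE_red hy hz).1⟩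
      · exact ⟨z.form, by simpa using .inr (.inr ⟨z, hz, rfl⟩), subset_rfl, subset_rfl⟩
  refine ⟨A, ⟨hA, ?_⟩, fun T Z hTZ h => hAc T Z hTZ fun y hy => ?_⟩
  · rw [Multiset.cons_swap]
    refine .rule x hx fun y hy => ?_
    rw [Multiset.add_cons]
    exact hAd y hy
  · change Der (T + S) (Z + x ::ₘ X) at h
    rw [Multiset.add_cons] at h
    rw [add_left_comm, add_left_comm Z]
    exact h.invert hx hy

/-! #### Critical sequents -/

lemma body_form_mem {G : Grp Agent} {φ : Form Var Agent} {U : Multiset (Form Var Agent)}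
    (h : φ ∈ ((body G S).map left).map form + U) : (∃ σ ∈ S, φ.SymLE σ) ∨ φ ∈ U := by
  rcases Multiset.mem_add.1 h with h | h
  · simp only [Multiset.map_map, Function.comp_def, form, Multiset.map_id'] at h
    obtain ⟨σ, hσ, hle, -⟩ := symLE_of_mem_body h
    exact .inl ⟨σ, hσ, hle⟩
  · exact .inr h

lemma isContext_body {T : Multiset (Form Var Agent)} {G : Grp Agent}
    (hT : ∀ θ ∈ T, Form.Fresh p a θ) : IsContext p a 0 ((body G T).map left) where
  boxed := by simp
  fresh_storage := by simp
  fresh z hz := by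
    obtain ⟨φ, hφ, rfl⟩ := Multiset.mem_map.1 hz
    obtain ⟨θ, hθ, hle, -⟩ := symLE_of_mem_body hφ
    exact (hT θ hθ).mono hle

/-- On a storage without `a`, removing `a` from the group does not change the body. -/
lemma body_congr_of_fresh {T : Multiset (Form Var Agent)} (hT : ∀ θ ∈ T, Form.Fresh p a θ)
    {G G' : Grp Agent} (h : ∀ b, b ∈ G'.1 ↔ b ∈ G.1 ∧ b ≠ a) : body G T = body G' T := by
  refine body_congr fun H α hH => ⟨fun hs b hb => (h b).2 ⟨hs hb, ?_⟩, fun hs b hb =>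
    ((h b).1 (hs hb)).1⟩
  rintro rfl
  exact (hT _ hH).2 (.inl hb)

/-- The disjunct that covers the applications of `(D_K⁺)` whose principal formula `D_G β` belongs to
the sequent: it is `D_{G \ {a}} A` for an interpolant `A` of the premiss. -/
lemma exists_covers_box_mem (hS : ∀ σ ∈ S, Form.IsBoxed σ) (hX : ∀ x ∈ X, SForm.IsCrit x)
    (hn : ¬ Der S X) {G : Grp Agent} {β : Form Var Agent} (hG : right (.box G β) ∈ X)
    (ih : ∃ A, IsInterpolant p a 0 ((body G S).map left + {right β}) A) :
    ∃ A, IsSound p a S X A ∧ Covers p a (fun T Z => (∀ z ∈ Z, SForm.IsCrit z) ∧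
      Der 0 (right β ::ₘ (body G (T + S)).map left)) A := by
  classical
  by_cases hGa : (G.1.erase a).Nonempty
  · let G' : Grp Agent := ⟨G.1.erase a, hGa⟩
    have hG' : ∀ b, b ∈ G'.1 ↔ b ∈ G.1 ∧ b ≠ a := fun b => by simp [G', and_comm]
    obtain ⟨A, hA⟩ := ih
    have hGX : Form.box G β ∈ S + X.map form :=
      Multiset.mem_add.2 (.inr (Multiset.mem_map.2 ⟨_, hG, rfl⟩))
    refine ⟨.box G' A, ⟨Form.Over.box (hA.syms.mono fun φ hφ => ?_) (fun b hb => ?_) ?_,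
      .boxT ?_⟩, fun T Z hTZ hC => ?_⟩
    · rw [zero_add, Multiset.map_add] at hφ
      rcases body_form_mem hφ with ⟨σ, hσ, hle⟩ | hφ
      · exact ⟨σ, Multiset.mem_add.2 (.inl hσ), hle⟩
      · simp only [Multiset.map_singleton, Multiset.mem_singleton] at hφ
        subst hφ
        exact ⟨_, hGX, subset_rfl, Set.subset_union_right⟩
    · exact ⟨_, hGX, .inl ((hG' b).1 hb).1⟩
    · exact fun h => ((hG' a).1 h).2 rfl
    · refine .weaken_cons _ (.boxK G β ?_ hX hG ?_)
      · simpa using ⟨⟨_, _, rfl⟩, hS⟩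
      · rw [body_cons_of_subset (Finset.erase_subset _ _), Multiset.map_cons, Multiset.cons_swap]
        simpa [Multiset.add_comm _ {right β}] using hA.der
    · refine .boxK G' A hTZ.boxed ?_ (Multiset.mem_cons_self _ _) ?_
      · simpa using ⟨.inr ⟨_, _, rfl⟩, hC.1⟩
      · rw [← body_congr_of_fresh hTZ.fresh_storage hG']
        refine hA.covers _ _ (isContext_body hTZ.fresh_storage) ?_
        change Der (0 + 0) (_ + (_ + _))
        rw [← add_assoc, ← Multiset.map_add, ← body_add, add_zero, add_comm]
        exact hC.2
  · -- Here `G = {a}`, so no formula of `T` is used and the sequent itself is derivable.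
    refine ⟨.bot, .bot hS, fun T Z hTZ hC => absurd ?_ hn⟩
    have hT : body G T = 0 := by
      refine Multiset.eq_zero_of_forall_notMem fun α hα => ?_
      obtain ⟨H, hH, hHT⟩ := mem_body.1 hα
      obtain ⟨b, hb⟩ := H.2
      refine hGa ⟨b, Finset.mem_erase.2 ⟨?_, hH hb⟩⟩
      rintro rfl
      exact (hTZ.fresh_storage _ hHT).2 (.inl hb)
    refine .boxK G β hS hX hG ?_
    simpa [body_add, hT] using hC.2

/-- The disjunct that covers the applications of `(D_K⁺)` whose principal formula belongs to the
context and which use the same formulas of `S` as the group `G'` does: it is `¬ D_{G'} ¬ A` for an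
interpolant `A` of the sequent consisting of these formulas. -/
lemma exists_covers_group (hS : ∀ σ ∈ S, Form.IsBoxed σ) (hX : ∀ x ∈ X, SForm.IsCrit x)
    {G' : Grp Agent} (ha : a ∉ G'.1)
    (hGS : ∀ b ∈ G'.1, b ∈ Form.multisetAgents S)
    (ih : ∃ A, IsInterpolant p a 0 ((body G' S).map left) A) :
    ∃ A, IsSound p a S X A ∧ Covers p a (fun T Z => (∀ z ∈ Z, SForm.IsCrit z) ∧
      ∃ G β, right (.box G β) ∈ Z ∧ G'.1 ⊆ G.1 ∧ body G S = body G' S ∧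
        Der 0 (right β ::ₘ (body G (T + S)).map left)) A := by
  obtain ⟨A, hA⟩ := ih
  refine ⟨.neg (.box G' (.neg A)), ⟨.neg (.box (.neg (hA.syms.mono fun φ hφ => ?_)) ?_ ha), ?_⟩, ?_⟩
  · rw [zero_add, ← add_zero (Multiset.map form _)] at hφ
    obtain ⟨σ, hσ, hle⟩ | hφ := body_form_mem hφ
    · exact ⟨σ, Multiset.mem_add.2 (.inl hσ), hle⟩
    · simp at hφ
  · intro b hb
    obtain ⟨σ, hσ, hbσ⟩ := hGS b hb
    exact ⟨σ, Multiset.mem_add.2 (.inl hσ), hbσ⟩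
  · refine .negL (.boxK G' (.neg A) hS ?_ (Multiset.mem_cons_self _ _) (.negR hA.der))
    simpa using ⟨.inr ⟨_, _, rfl⟩, hX⟩
  · rintro T Z hTZ ⟨hZ, G, β, hG, hGG, hbody, h⟩
    refine .negR (.boxT (.weaken_cons _ (.boxK G β ?_ hZ hG ?_)))
    · simpa using ⟨⟨_, _, rfl⟩, hTZ.boxed⟩
    rw [body_cons_of_subset hGG, Multiset.map_cons, Multiset.cons_swap]
    refine .negL (hA.covers 0 _ ⟨by simp, by simp, ?_⟩ ?_)
    · intro z hz
      rcases Multiset.mem_cons.1 hz with rfl | hz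
      · exact (hTZ.fresh _ hG).mono ⟨subset_rfl, Set.subset_union_right⟩
      · exact (isContext_body hTZ.fresh_storage).fresh z hz
    · change Der (0 + 0) (_ + _)
      rw [Multiset.cons_add, ← Multiset.map_add, ← hbody, ← body_add, add_zero]
      exact h

/-- The contexts in which the member `x` of a critical sequent `S | X` takes part in the last inference:
`x` closes an axiom together with a formula of the context, or `x` is principal in `(D_K⁺)`. -/
def UsesMember (S : Multiset (Form Var Agent)) (x : SForm Var Agent)
    (T : Multiset (Form Var Agent)) (Z : Multiset (SForm Var Agent)) : Prop :=
  match x with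
  | left φ => ∃ q, φ = .atom q ∧ right (.atom q) ∈ Z
  | right φ => (∃ q, φ = .atom q ∧ left (.atom q) ∈ Z) ∨
      ∃ G β, φ = .box G β ∧ (∀ z ∈ Z, SForm.IsCrit z) ∧
        Der 0 (right β ::ₘ (body G (T + S)).map left)

lemma exists_covers_mem (hS : ∀ σ ∈ S, Form.IsBoxed σ) (hX : ∀ x ∈ X, SForm.IsCrit x)
    (hn : ¬ Der S X) {x : SForm Var Agent} (hx : x ∈ X)
    (ih : ∀ G β, right (.box G β) ∈ X →
      ∃ A, IsInterpolant p a 0 ((body G S).map left + {right β}) A) :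
    ∃ A, IsSound p a S X A ∧ Covers p a (UsesMember S x) A := by
  have hmem : x.form ∈ S + X.map form :=
    Multiset.mem_add.2 (.inr (Multiset.mem_map_of_mem form hx))
  cases x with
  | left φ =>
    by_cases hφ : ∃ q, q ≠ p ∧ φ = .atom q
    · obtain ⟨q, hq, rfl⟩ := hφ
      refine ⟨.neg (.atom q), ⟨(Form.over_atom a hmem hq).neg, .negL ?_⟩, fun T Z hTZ hC => ?_⟩
      · exact .init q hS (Multiset.mem_cons_of_mem hx) (Multiset.mem_cons_self _ _)
      · obtain ⟨q', he, hZ⟩ := hC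
        cases he
        exact .negR (.init q hTZ.boxed (Multiset.mem_cons_self _ _) (Multiset.mem_cons_of_mem hZ))
    · refine ⟨.bot, .bot hS, ?_⟩
      rintro T Z hTZ ⟨q, rfl, hZ⟩
      refine absurd ⟨q, ?_, rfl⟩ hφ
      rintro rfl
      exact (hTZ.fresh _ hZ).1 rfl
  | right φ =>
    by_cases hφ : ∃ q, q ≠ p ∧ φ = .atom q
    · obtain ⟨q, hq, rfl⟩ := hφ
      refine ⟨.atom q, ⟨Form.over_atom a hmem hq, ?_⟩, fun T Z hTZ hC => ?_⟩
      · exact .init q hS (Multiset.mem_cons_self _ _) (Multiset.mem_cons_of_mem hx)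
      · obtain ⟨q', he, hZ⟩ | ⟨G, β, he, -⟩ := hC <;> cases he
        exact .init q hTZ.boxed (Multiset.mem_cons_of_mem hZ) (Multiset.mem_cons_self _ _)
    by_cases hbox : φ.IsBoxed
    · obtain ⟨G, β, rfl⟩ := hbox
      obtain ⟨A, hA, hAc⟩ := exists_covers_box_mem hS hX hn hx (ih G β hx)
      refine ⟨A, hA, fun T Z hTZ hC => hAc T Z hTZ ?_⟩
      obtain ⟨q', he, hZ⟩ | ⟨G, β, he, hC⟩ := hC <;> cases he
      exact hC
    · refine ⟨.bot, .bot hS, ?_⟩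
      rintro T Z hTZ (⟨q, rfl, hZ⟩ | ⟨G, β, rfl, -⟩)
      · refine absurd ⟨q, ?_, rfl⟩ hφ
        rintro rfl
        exact (hTZ.fresh _ hZ).1 rfl
      · exact absurd ⟨G, β, rfl⟩ hbox

/-- A sound formula covers the whole sequent once it covers the last inferences in which a formula of
the critical sequent `S | X` takes part. The invertible rules act on the context alone, and when
`(D_K⁺)` has a principal formula `D_G β` in the context, the relevant part of `S` is determined by
the agents of `G` that occur in `S`. -/
lemma covers_of_crit (hS : ∀ σ ∈ S, Form.IsBoxed σ) (hX : ∀ x ∈ X, SForm.IsCrit x)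
    (hn : ¬ Der S X) {A : Form Var Agent} (hmem : ∀ x ∈ X, Covers p a (UsesMember S x) A)
    (hgrp : ∀ G' : Grp Agent, a ∉ G'.1 → (∀ b ∈ G'.1, b ∈ Form.multisetAgents S) →
      Covers p a (fun T Z => (∀ z ∈ Z, SForm.IsCrit z) ∧
        ∃ G β, right (.box G β) ∈ Z ∧ G'.1 ⊆ G.1 ∧ body G S = body G' S ∧
          Der 0 (right β ::ₘ (body G (T + S)).map left)) A) :
    Covers p a (fun T Z => Der (T + S) (Z + X)) A := by
  classical
  intro T Z hTZ h
  change Der (T + S) (Z + X) at h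
  generalize hU : T + S = U at h
  generalize hW : Z + X = W at h
  induction h generalizing T Z with
  | init q hSU hl hr =>
    subst hU hW
    rcases Multiset.mem_add.1 hl with hl | hl <;> rcases Multiset.mem_add.1 hr with hr | hr
    · exact .weaken_cons _ (.init q hTZ.boxed hl hr)
    · exact hmem _ hr T Z hTZ (.inl ⟨q, rfl, hl⟩)
    · exact hmem _ hl T Z hTZ ⟨q, rfl, hr⟩
    · exact absurd (.init q hS hl hr) hn
  | initBot hSU hl =>
    subst hU hW
    rcases Multiset.mem_add.1 hl with hl | hl
    · exact .weaken_cons _ (.initBot hTZ.boxed hl)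
    · exact absurd (.initBot hS hl) hn
  | @rule U V x hx _ ih =>
    subst hU
    have hxZ : x ∈ Z := by
      have : x ∈ Z + X := hW ▸ Multiset.mem_cons_self _ _
      exact (Multiset.mem_add.1 this).resolve_right fun h => hx (hX x h)
    obtain ⟨Z, rfl⟩ := Multiset.exists_cons_of_mem hxZ
    rw [Multiset.cons_add] at hW
    obtain rfl := (Multiset.cons_inj_right x).1 hW
    have hxf := hTZ.fresh x hxZ
    rw [Multiset.cons_swap]
    refine .rule x hx fun y hy => ?_
    rw [Multiset.add_cons]
    refine ih y hy _ _ ⟨fun θ hθ => ?_, fun θ hθ => ?_, fun z hz => ?_⟩ (add_assoc ..)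
      (add_assoc ..)
    · exact (Multiset.mem_add.1 hθ).elim (fun h => (storage_red hy h).2) (hTZ.boxed θ)
    · rcases Multiset.mem_add.1 hθ with h | h
      · rw [(storage_red hy h).1]
        exact hxf
      · exact hTZ.fresh_storage θ h
    · rcases Multiset.mem_add.1 hz with h | h
      · exact hxf.mono (symLE_red hy h).1
      · exact hTZ.fresh z (Multiset.mem_cons_of_mem h)
  | boxK G β hSU hcrit hr h _ =>
    subst hU hW
    have hZ : ∀ z ∈ Z, SForm.IsCrit z := fun z hz => hcrit z (Multiset.mem_add.2 (.inl hz))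
    rcases Multiset.mem_add.1 hr with hr | hr
    · have haG : a ∉ G.1 := fun h => (hTZ.fresh _ hr).2 (.inl h)
      by_cases hne : (G.1.filter (· ∈ Form.multisetAgents S)).Nonempty
      · refine hgrp ⟨_, hne⟩ (fun h => haG (Finset.mem_filter.1 h).1)
          (fun b hb => (Finset.mem_filter.1 hb).2) T Z hTZ
          ⟨hZ, G, β, hr, Finset.filter_subset _ _, ?_, h⟩
        refine body_congr fun H α hH => ⟨fun hs b hb => Finset.mem_filter.2 ⟨hs hb, ?_⟩,
          fun hs => hs.trans (Finset.filter_subset _ _)⟩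
        exact ⟨_, hH, .inl hb⟩
      · -- No agent of `G` occurs in `S`, hence the inference uses no formula of `S`.
        have hbS : body G S = 0 := by
          refine Multiset.eq_zero_of_forall_notMem fun α hα => ?_
          obtain ⟨H, hH, hHS⟩ := mem_body.1 hα
          obtain ⟨b, hb⟩ := H.2
          exact hne ⟨b, Finset.mem_filter.2 ⟨hH hb, _, hHS, .inl hb⟩⟩
        rw [body_add, hbS, add_zero] at h
        exact .weaken_cons _ (.boxK G β hTZ.boxed hZ hr h)
    · exact hmem _ hr T Z hTZ (.inr ⟨G, β, rfl, hZ, h⟩)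

lemma exists_isInterpolant_crit [Finite Agent] (hS : ∀ σ ∈ S, Form.IsBoxed σ)
    (hX : ∀ x ∈ X, SForm.IsCrit x)
    (ihR : ∀ G β, right (.box G β) ∈ X →
      ∃ A, IsInterpolant p a 0 ((body G S).map left + {right β}) A)
    (ihL : ∀ G, S ≠ 0 → ∃ A, IsInterpolant p a 0 ((body G S).map left) A) :
    ∃ A, IsInterpolant p a S X A := by
  by_cases hn : Der S X
  · exact ⟨_, isInterpolant_top hn⟩
  obtain ⟨A, hA, hAc⟩ := exists_isSound_covers (Multiset.finite_toSet X) hS (UsesMember S)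
    fun x hx => exists_covers_mem (p := p) (a := a) hS hX hn hx ihR
  obtain ⟨B, hB, hBc⟩ := exists_isSound_covers
    (Set.toFinite {G' : Grp Agent | a ∉ G'.1 ∧ ∀ b ∈ G'.1, b ∈ Form.multisetAgents S}) hS _
    fun G' hG' => exists_covers_group (p := p) hS hX hG'.1 hG'.2 <| ihL G' <| by
      obtain ⟨b, hb⟩ := G'.2
      obtain ⟨σ, hσ, -⟩ := hG'.2 b hb
      rintro rfl
      simp at hσ
  refine ⟨A.or B, hA.or hB, covers_of_crit hS hX hn (fun x hx T Z hTZ hC => .orR ?_)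
    fun G' ha hG' T Z hTZ hC => .orR ?_⟩
  · rw [Multiset.cons_swap]
    exact .weaken_cons _ (hAc x hx T Z hTZ hC)
  · exact .weaken_cons _ (hBc G' ⟨ha, hG'⟩ T Z hTZ hC)

/-! #### Existence -/

/-- Interpolants exist. The recursion is on the modal depth, which drops in the premisses of `(D_K⁺)`,
and for a fixed depth on the total size of `X`, which drops in the premisses of the other rules; the
storage does not count for the size. -/
theorem exists_isInterpolant [Finite Agent] (n : ℕ) (hS : ∀ σ ∈ S, Form.IsBoxed σ)
    (hSn : ∀ σ ∈ S, Form.depth σ ≤ n) (hXn : ∀ x ∈ X, (form x).depth ≤ n) :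
    ∃ A, IsInterpolant p a S X A := by
  induction n using Nat.strong_induction_on generalizing S X with
  | _ n ihn =>
  induction hw : weight X using Nat.strong_induction_on generalizing S X with
  | _ w ihw =>
  subst hw
  by_cases hX : ∀ x ∈ X, SForm.IsCrit x
  · have hbody : ∀ G (m : ℕ), (∀ σ ∈ S, Form.depth σ ≤ m + 1) →
        ∀ x ∈ (body G S).map left, (form x).depth ≤ m := by
      intro G m hm x hx
      obtain ⟨α, hα, rfl⟩ := Multiset.mem_map.1 hx
      obtain ⟨σ, hσ, -, hlt⟩ := symLE_of_mem_body hα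
      exact Nat.lt_succ_iff.1 (hlt.trans_le (hm σ hσ))
    refine exists_isInterpolant_crit hS hX (fun G β hβ => ?_) fun G => ?_
    · have hd : β.depth + 1 ≤ n := hXn _ hβ
      obtain ⟨m, rfl⟩ : ∃ m, n = m + 1 := ⟨n - 1, by omega⟩
      refine ihn m (Nat.lt_succ_self m) (by simp) (by simp) fun x hx => ?_
      rcases Multiset.mem_add.1 hx with hx | hx
      · exact hbody G m hSn x hx
      · rw [Multiset.mem_singleton.1 hx]
        exact Nat.succ_le_succ_iff.1 hd
    · -- A boxed formula has positive depth, so a nonempty `S` forces `n` to be positive.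
      intro hS0
      obtain ⟨σ, hσ⟩ := Multiset.exists_mem_of_ne_zero hS0
      obtain ⟨H, α, rfl⟩ := hS σ hσ
      have hd : α.depth + 1 ≤ n := hSn _ hσ
      obtain ⟨m, rfl⟩ : ∃ m, n = m + 1 := ⟨n - 1, by omega⟩
      exact ihn m (Nat.lt_succ_self m) (by simp) (by simp) (hbody G m hSn)
  · push Not at hX
    obtain ⟨x, hx, hxc⟩ := hX
    obtain ⟨X, rfl⟩ := Multiset.exists_cons_of_mem hx
    refine exists_isInterpolant_cons hxc fun y hy => ?_
    have hxn := hXn x hx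
    refine ihw _ ?_ (fun σ hσ => ?_) (fun σ hσ => ?_) (fun z hz => ?_) rfl
    · rw [weight_add, weight_cons]
      exact Nat.add_lt_add_right (weight_red hy) _
    · exact (Multiset.mem_add.1 hσ).elim (fun h => (storage_red hy h).2) (hS σ)
    · rcases Multiset.mem_add.1 hσ with h | h
      · rw [(storage_red hy h).1]
        exact hxn
      · exact hSn σ h
    · rcases Multiset.mem_add.1 hz with h | h
      · exact (symLE_red hy h).2.trans hxn
      · exact hXn z (Multiset.mem_cons_of_mem h)

end Interpolation

theorem mainTheorem2 {Var Agent : Type*} [Countable Var] [Finite Agent]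
    (S Γ Δ : Multiset (Form Var Agent)) (hS : ∀ σ ∈ S, σ.IsBoxed) (p : Var) (a : Agent) :
    ∃ A : Form Var Agent,
      (A.vars ⊆ Form.multisetVars (S + Γ + Δ) \ {p} ∧
        A.agents ⊆ Form.multisetAgents (S + Γ + Δ) \ {a}) ∧
      KTPlus S (A ::ₘ Γ) Δ ∧
      ∀ P L T : Multiset (Form Var Agent), (∀ θ ∈ T, θ.IsBoxed) →
        p ∉ Form.multisetVars (P + L + T) → a ∉ Form.multisetAgents (P + L + T) →
        KTPlus (T + S) (P + Γ) (Δ + L) →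
        KTPlus 0 (T + P) (A ::ₘ L) := by
  obtain ⟨n, hn⟩ : ∃ n, ∀ φ ∈ S + Γ + Δ, φ.depth ≤ n :=
    ⟨((S + Γ + Δ).map Form.depth).sum, fun φ hφ =>
      Multiset.single_le_sum (fun _ _ => Nat.zero_le _) _ (Multiset.mem_map_of_mem _ hφ)⟩
  have hform : (Der.sign Γ Δ).map SForm.form = Γ + Δ := by
    simp [Der.sign, Function.comp_def, SForm.form]
  have hsign : ∀ {x}, x ∈ Der.sign Γ Δ → x.form ∈ Γ + Δ := fun hx =>
    hform ▸ Multiset.mem_map_of_mem SForm.form hx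
  obtain ⟨A, hA⟩ := exists_isInterpolant (p := p) (a := a) (S := S) (X := Der.sign Γ Δ) n hS
    (fun σ hσ => hn σ (by simp [hσ]))
    (fun x hx => hn _ (by rw [add_assoc]; exact Multiset.mem_add.2 (.inr (hsign hx))))
  have hsyms := hA.syms
  rw [hform, ← add_assoc] at hsyms
  refine ⟨A, hsyms, hA.der.toKTPlus (Der.sign_cons_left ..).symm, fun P L T hT hp ha h => ?_⟩
  have hfresh : ∀ φ ∈ P + L + T, Form.Fresh p a φ := fun φ hφ =>
    ⟨fun h => hp ⟨φ, hφ, h⟩, fun h => ha ⟨φ, hφ, h⟩⟩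
  have hd : Der T (SForm.right A ::ₘ Der.sign P L) := by
    refine hA.covers T _ ⟨hT, fun θ hθ => hfresh θ (by simp [hθ]), fun z hz => hfresh _ ?_⟩ ?_
    · cases z with
      | left φ => simp [SForm.form, Der.left_mem_sign.1 hz]
      | right φ => simp [SForm.form, Der.right_mem_sign.1 hz]
    · have e : Der.sign P L + Der.sign Γ Δ = Der.sign (P + Γ) (Δ + L) := by
        simp only [Der.sign, Multiset.map_add]
        abel
      simpa only [e] using Der.of_ktPlus h
  refine (Der.unstore (S := 0) hT (by rwa [add_zero])).toKTPlus ?_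
  rw [← Der.sign_cons_right, Der.sign, Der.sign, Multiset.map_add, add_assoc]
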